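/- Let $m,q,k\ge 1$ and let $\Omega$ be a totally ordered alphabet with $q$ letters $\omega_1<\dots<\omega_q$. For a word $s=c_1\cdots c_n$ over $\Omega$, let $(s)$ denote the cyclic word of $s$ (the class of $s$ under rotation), and let $s^i$ denote the concatenation of $i$ copies of $s$. The order of $(s)$ is the largest divisor $d$ of $n$ such that rotating $s$ by $n/d$ positions gives $s$ again. A word $w$ of length $k$ occurs in $(s)$ at a starting position $j$ if $w$ is a prefix of some power of the rotation of $s$ that starts at position $j$. Let $\mathcal{C}^{(d)}(m,q,k)$ be the set of cyclic words over $\Omega$ of order $d$ in which each of the $q^k$ words of length $k$ over $\Omega$ occurs at exactly $m$ starting positions. The Burrows-Wheeler transform $\mathrm{BWT}(s)$ of a word $s$ of length $n$ is obtained by sorting the $n$ rotations of $s$ by $0,\dots,n-1$ positions (with repetitions) lexicographically as the rows of an $n\times n$ table, and reading the last column from top to bottom. Let $\mathcal{W}_{m,q}$ be the set of all permutations of the word $\omega_1^m\omega_2^m\cdots\omega_q^m$, and let $(\mathcal{W}_{m,q})^N$ denote the set of concatenations of $N$ words from $\mathcal{W}_{m,q}$. **Theorem.** Let $(s)\in\mathcal{C}^{(d)}(m,q,k)$.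 Then $d$ divides $m$, and $\mathrm{BWT}(s)=a_1^d a_2^d\cdots a_r^d$ for some nonempty word $a_1a_2\cdots a_r\in(\mathcal{W}_{m/d,q})^{q^{k-1}}$ with letters $a_1,\dots,a_r\in\Omega$. Moreover, $a_1a_2\cdots a_r$ is not of the form $b_1^i b_2^i\cdots$ with letters $b_1,b_2,\ldots\in\Omega$ for any integer $i>1$. -/

import Mathlib

namespace MultiDeBruijn

variable {Ω : Type*}

/-- The `i`-th power `sⁱ` of a word `s`: the concatenation of `i` copies of `s`. -/
def wordPow (s : List Ω) (i : ℕ) : List Ω :=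
  (List.replicate i s).flatten

/-- `stretch i (a₁ a₂ … aᵣ) = a₁ⁱ a₂ⁱ … aᵣⁱ`: every letter is repeated `i` times in place. -/
def stretch (i : ℕ) (u : List Ω) : List Ω :=
  u.flatMap (List.replicate i)

/-- The words that do not repeat every letter in place: the nonempty words that are
not of the form `b₁ⁱ b₂ⁱ …` for any `i > 1`. -/
def nonStretched (Ω : Type*) : Set (List Ω) :=
  {w | w ≠ [] ∧ ¬ ∃ i : ℕ, 1 < i ∧ ∃ b : List Ω, w = stretch i b}

open Classical in
/-- The number of occurrences of the nonempty word `w` in the cyclic word `c`. The multiset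
`c.lists` lists the `|c|` rotations of `c` (one for each starting position, with repetitions),
and `w` occurs at a position if `w` is a prefix of some power of the rotation starting there. -/
noncomputable def occurrences (c : Cycle Ω) (w : List Ω) : ℕ :=
  c.lists.countP (fun t => ∃ i : ℕ, w <+: wordPow t i)

/-- `C(m,q,k)` over the alphabet `Ω` (with `q` letters): the cyclic words in which every
`k`-mer occurs exactly `m` times. -/
def cyclicMDB (Ω : Type*) (m k : ℕ) : Set (Cycle Ω) :=
  {c | ∀ w : List Ω, w.length = k → occurrences c w = m}

/-- `s` has a rotation of order `d`: `d` divides `n = |s|`, and rotating `s` by `n / d`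
positions gives `s` back. -/
def HasRotation (s : List Ω) (d : ℕ) : Prop :=
  d ∣ s.length ∧ s.rotate (s.length / d) = s

theorem hasRotation_congr {s t : List Ω} (h : s ~r t) (d : ℕ) :
    HasRotation s d = HasRotation t d := by
  obtain ⟨j, rfl⟩ := h
  unfold HasRotation
  rw [List.length_rotate, List.rotate_rotate, Nat.add_comm j, ← List.rotate_rotate,
    (List.rotate_injective j).eq_iff]

/-- The cyclic word `c` has a rotation of order `d` (this does not depend on the linearization). -/
def CycleHasRotation (c : Cycle Ω) (d : ℕ) : Prop :=
  Quotient.liftOn c (fun s => HasRotation s d) (fun _ _ h => hasRotation_congr h d)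

theorem cycleHasRotation_coe (s : List Ω) (d : ℕ) :
    CycleHasRotation (s : Cycle Ω) d ↔ HasRotation s d := by
  rw [← Cycle.mk''_eq_coe]
  rfl

/-- `d` is the order of the cyclic word `c`: the largest `d` such that `c` has a rotation of
order `d`. -/
def IsOrder (c : Cycle Ω) (d : ℕ) : Prop :=
  IsGreatest {e : ℕ | CycleHasRotation c e} d

/-- `C⁽ᵈ⁾(m,q,k)`: the cyclic multi de Bruijn sequences of order `d`. -/
def cyclicMDBOfOrder (Ω : Type*) (d m k : ℕ) : Set (Cycle Ω) :=
  {c | c ∈ cyclicMDB Ω m k ∧ IsOrder c d}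

/-- `𝒲_{m,q}` over the alphabet `Ω` (with `q` letters): the set of all permutations of the word
`ω₁ᵐ ω₂ᵐ … ω_qᵐ`, where `ω₁ < … < ω_q` are the letters. It is given as a `Language`, so that its
powers are formed by concatenation. -/
def codewords (Ω : Type*) [LinearOrder Ω] [Fintype Ω] (m : ℕ) : Language Ω :=
  {w : List Ω | w.Perm (stretch m ((Finset.univ : Finset Ω).sort (· ≤ ·)))}

/-- The Burrows-Wheeler table of `s`: the rotations of `s` by `0, …, |s| - 1` positions, sorted
into lexicographic order. -/
def bwtTable [LinearOrder Ω] (s : List Ω) : List (List Ω) :=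
  ((List.range s.length).map (fun j => s.rotate j)).insertionSort (· ≤ ·)

/-- The Burrows-Wheeler transform of `s`: the last column of its Burrows-Wheeler table, read from
top to bottom. -/
def BWT [LinearOrder Ω] (s : List Ω) : List Ω :=
  (bwtTable s).filterMap List.getLast?

end MultiDeBruijn

namespace MultiDeBruijn

/-! ### Counting over one period of a periodic predicate. -/

section Counting

/-! Write `n = d * p` for the length of `s` and `g` for the `p`-periodic word `sss…`. Each row of
the table occurs `d` times as often as among the rotations by `0, …, p - 1`, so the transform is
`stretch d u`, where `u` lists the letters preceding these `p` sorted positions (`BWT_eq_stretch`).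
Positions followed by the same word `x` of length `k - 1` are consecutive. In that block of `u` a
letter `c` appears as often as `c :: x` occurs in one period, namely `m / d` times
(`map_last_mem_pow`). If `u = stretch i b`, induction on word length shows that the number of
positions whose factor lies below any given word is a multiple of `i` (`dvd_count_factor_lt`). Since
`d` is the order, the `p` rows are distinct, so exactly one lies below the second; hence `i` divides
1 (`map_last_not_stretch`). -/

theorem countP_range (P : ℕ → Prop) [DecidablePred P] (n : ℕ) :
    (List.range n).countP (fun j => decide (P j)) = Nat.count P n := by
  induction n with
  | zero => rfl
  | succ n ih => simp [List.range_succ, List.countP_append, ih, Nat.count_succ, List.countP_cons]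

theorem count_mul_of_periodic (P : ℕ → Prop) [DecidablePred P] {p : ℕ}
    (hP : Function.Periodic P p) (d : ℕ) : Nat.count P (d * p) = d * Nat.count P p := by
  induction d with
  | zero => simp
  | succ d ih =>
    have h : (fun k => P (p + k)) = P := by
      funext k
      rw [Nat.add_comm, hP k]
    have h' : Nat.count (fun k => P (p + k)) (d * p) = Nat.count P (d * p) := by
      simp only [h]
    rw [Nat.succ_mul, Nat.add_comm, Nat.count_add, h', ih]
    ring

theorem count_shift_of_periodic (P : ℕ → Prop) [DecidablePred P] {p : ℕ}
    (hP : Function.Periodic P p) (t : ℕ) :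
    Nat.count (fun j => P (j + t)) p = Nat.count P p := by
  have h1 := Nat.count_add P t p
  have h2 := Nat.count_add P p t
  have h : (fun k => P (p + k)) = P := by
    funext k
    rw [Nat.add_comm, hP k]
  have h' : Nat.count (fun k => P (p + k)) t = Nat.count P t := by simp only [h]
  have h'' : Nat.count (fun k => P (t + k)) p = Nat.count (fun j => P (j + t)) p := by
    simp only [Nat.add_comm]
  rw [Nat.add_comm p t] at h2
  omega

end Counting

/-! ### Words with every letter repeated in place. -/

section Stretch

variable {α : Type*}

@[simp] theorem stretch_nil (i : ℕ) : stretch i ([] : List α) = [] := rfl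

@[simp] theorem stretch_cons (i : ℕ) (a : α) (u : List α) :
    stretch i (a :: u) = List.replicate i a ++ stretch i u := by
  simp [stretch]

@[simp] theorem length_stretch (i : ℕ) (u : List α) : (stretch i u).length = i * u.length := by
  induction u with
  | nil => simp
  | cons a u ih => simp [ih]; ring

theorem countP_stretch (P : α → Bool) (i : ℕ) (u : List α) :
    (stretch i u).countP P = i * u.countP P := by
  induction u with
  | nil => simp
  | cons a u ih =>
    rw [stretch_cons, List.countP_append, ih, List.countP_replicate, List.countP_cons]
    split_ifs <;> ring

theorem count_stretch [BEq α] (a : α) (i : ℕ) (u : List α) :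
    (stretch i u).count a = i * u.count a :=
  countP_stretch _ i u

theorem pairwise_stretch {R : α → α → Prop} (hR : ∀ a, R a a) (i : ℕ) {u : List α}
    (hu : u.Pairwise R) : (stretch i u).Pairwise R := by
  induction u with
  | nil => simp
  | cons a u ih =>
    rw [List.pairwise_cons] at hu
    rw [stretch_cons, List.pairwise_append]
    refine ⟨List.pairwise_replicate.2 (Or.inr (hR a)), ih hu.2, ?_⟩
    intro x hx y hy
    obtain rfl := List.eq_of_mem_replicate hx
    simp only [stretch, List.mem_flatMap, List.mem_replicate] at hy
    obtain ⟨b, hb, -, rfl⟩ := hy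
    exact hu.1 _ hb

theorem take_stretch (i t : ℕ) (u : List α) :
    (stretch i u).take (i * t) = stretch i (u.take t) := by
  induction u generalizing t with
  | nil => simp
  | cons a u ih =>
    cases t with
    | zero => simp
    | succ t =>
      rw [stretch_cons, List.take_succ_cons, stretch_cons, Nat.mul_succ, Nat.add_comm,
        List.take_append, ← ih]
      simp

end Stretch

/-! ### Initial segments and blocks of a sorted list. -/

section Filter

variable {α β : Type*}

theorem filter_append_filter_not {R : α → α → Prop} (P : α → Bool) {J : List α}
    (hJ : J.Pairwise R) (hP : ∀ a b, R a b → P b → P a) :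
    J.filter P ++ J.filter (fun a => !P a) = J := by
  induction J with
  | nil => rfl
  | cons a J ih =>
    rw [List.pairwise_cons] at hJ
    by_cases ha : P a
    · simp [ha, ih hJ.2]
    · have : ∀ b ∈ J, ¬ P b := fun b hb h => ha (hP _ _ (hJ.1 b hb) h)
      have h1 : J.filter P = [] := List.filter_eq_nil_iff.2 this
      have h2 : J.filter (fun a => !P a) = J :=
        List.filter_eq_self.2 fun b hb => by simpa using this b hb
      simp [ha, h1, h2]

/-- `P` is closed downwards along `J`, so the elements satisfying it form an initial segment. -/
theorem take_countP {R : α → α → Prop} (P : α → Bool) {J : List α}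
    (hJ : J.Pairwise R) (hP : ∀ a b, R a b → P b → P a) :
    J.take (J.countP P) = J.filter P := by
  rw [List.countP_eq_length_filter]
  conv_lhs => rw [← filter_append_filter_not P hJ hP]
  rw [List.filter_append, List.filter_filter, List.filter_filter]
  simp

/-- As `f` is monotone along `J`, its fibres are consecutive blocks, met in the order of `K`. This
yields the cut into codewords. -/
theorem flatMap_filter_eq_self [LinearOrder β] {R : α → α → Prop} (f : α → β)
    (hf : ∀ a b, R a b → f a ≤ f b) {K : List β} (hK : K.Pairwise (· < ·)) {J : List α}
    (hJ : J.Pairwise R) (hJK : ∀ a ∈ J, f a ∈ K) :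
    K.flatMap (fun x => J.filter (fun a => f a = x)) = J := by
  induction K generalizing J with
  | nil =>
    cases J with
    | nil => rfl
    | cons a J => simpa using hJK a List.mem_cons_self
  | cons x K ih =>
    rw [List.pairwise_cons] at hK
    -- Membership is built into the relation because `x` is least only among the values listed in `x
    -- :: K`.
    have key := filter_append_filter_not (R := fun a b => R a b ∧ f a ∈ x :: K)
      (fun a => decide (f a = x)) (J := J)
      (hJ.imp_of_mem fun ha _ h => ⟨h, hJK _ ha⟩) (by
        rintro a b ⟨hab, ha⟩ hb
        simp only [decide_eq_true_eq] at hb ⊢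
        rcases List.mem_cons.1 ha with h | h
        · exact h
        · exact absurd (hf a b hab) (by rw [hb]; exact not_le.2 (hK.1 _ h)))
    have := ih hK.2 (J := J.filter (fun a => !decide (f a = x))) (hJ.filter _) (by
      intro a ha
      rw [List.mem_filter] at ha
      rcases List.mem_cons.1 (hJK a ha.1) with h | h
      · simp [h] at ha
      · exact h)
    rw [List.flatMap_cons]
    conv_rhs => rw [← key, ← this]
    congr 1
    simp only [List.flatMap_def]
    congr 1
    apply List.map_congr_left
    intro y hy
    rw [List.filter_filter]
    apply List.filter_congr
    intro a _
    have : y ≠ x := (hK.1 y hy).ne'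
    by_cases h : f a = y <;> simp [h, this]

end Filter

/-! ### Factors of a periodic infinite word and their order. -/

section Factor

variable {Ω : Type*}

/-- The word of length `l` that starts at position `j` of the infinite word `g`. -/
def factor (g : ℕ → Ω) : ℕ → ℕ → List Ω
  | 0, _ => []
  | l + 1, j => g j :: factor g l (j + 1)

@[simp] theorem length_factor (g : ℕ → Ω) (l j : ℕ) : (factor g l j).length = l := by
  induction l generalizing j with
  | zero => rfl
  | succ l ih => simp [factor, ih]

@[simp] theorem getElem_factor (g : ℕ → Ω) (l j i : ℕ) (h : i < (factor g l j).length) :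
    (factor g l j)[i] = g (j + i) := by
  induction l generalizing j i with
  | zero => simp at h
  | succ l ih =>
    cases i with
    | zero => simp [factor]
    | succ i => simp only [factor, List.getElem_cons_succ, ih]; congr 1; omega

theorem factor_periodic {g : ℕ → Ω} {p : ℕ} (hg : Function.Periodic g p) (l : ℕ) :
    Function.Periodic (factor g l) p := by
  intro j
  apply List.ext_getElem (by simp)
  intro i _ _
  rw [getElem_factor, getElem_factor, show j + p + i = j + i + p by omega, hg]

theorem factor_eq_of_factor_eq {g : ℕ → Ω} {n : ℕ} (hn : 0 < n) (hg : Function.Periodic g n)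
    {a b : ℕ} (h : factor g n a = factor g n b) (l : ℕ) : factor g l a = factor g l b := by
  apply List.ext_getElem (by simp)
  intro i _ _
  simp only [getElem_factor]
  have hi : i % n < n := Nat.mod_lt _ hn
  have key : ∀ c, g (c + i) = g (c + i % n) := by
    intro c
    have : c + i = c + i % n + (i / n) * n := by
      have := Nat.mod_add_div' i n
      omega
    rw [this]
    exact hg.nat_mul (i / n) (c + i % n)
  rw [key, key]
  have h1 : (factor g n a)[i % n]'(by simpa) = (factor g n b)[i % n]'(by simpa) := by simp only [h]
  simpa using h1

theorem factor_lt_of_factor_lt [LinearOrder Ω] (g : ℕ → Ω) {l l' : ℕ} (hl : l ≤ l') {a b : ℕ}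
    (h : factor g l a < factor g l b) : factor g l' a < factor g l' b := by
  induction l generalizing l' a b with
  | zero => exact absurd h (lt_irrefl _)
  | succ l ih =>
    obtain ⟨l', rfl⟩ : ∃ t, l' = t + 1 := ⟨l' - 1, by omega⟩
    simp only [factor, List.cons_lt_cons_iff] at h ⊢
    exact h.imp id fun h => ⟨h.1, ih (by omega) h.2⟩

/-- A strict comparison persists when both words are extended, and equality over a full period
propagates to all lengths. So sorting by rows also sorts by factors of any length `l`. -/
theorem factor_le_of_factor_le [LinearOrder Ω] {g : ℕ → Ω} {n : ℕ} (hn : 0 < n)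
    (hg : Function.Periodic g n) {a b : ℕ} (h : factor g n a ≤ factor g n b) (l : ℕ) :
    factor g l a ≤ factor g l b := by
  rcases h.eq_or_lt with h | h
  · exact (factor_eq_of_factor_eq hn hg h l).le
  · by_contra! h'
    rcases le_total l n with hl | hl
    · exact lt_asymm h (factor_lt_of_factor_lt g hl h')
    · exact lt_asymm h' (factor_lt_of_factor_lt g hl h)

end Factor

/-! ### The preceding letters do not form a stretched word. -/

section Sorted

variable {Ω : Type*} [LinearOrder Ω] {g : ℕ → Ω} {p n : ℕ} {J : List ℕ}

/-- For positions `J` of one period, sorted by the factors starting there: if the word of letters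
preceding them repeats every letter `i` times in place, then the number of positions whose factor is
below a given word is a multiple of `i`. -/
theorem dvd_count_factor_lt (hn : 0 < n) (hp : 0 < p) (hgn : Function.Periodic g n)
    (hg : Function.Periodic g p) (hJ : J.Pairwise fun a b => factor g n a ≤ factor g n b)
    (hJp : J.Perm (List.range p)) {i : ℕ} {b : List Ω}
    (hb : J.map (fun j => g (j + (p - 1))) = stretch i b) (l : ℕ) (x : List Ω) :
    i ∣ Nat.count (fun j => factor g l j < x) p := by
  -- The preceding letters, taken over one period, are all the letters of the period, so letter
  -- counts can be read off `stretch i b`.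
  have hlast : ∀ (P : Ω → Prop) [DecidablePred P], i ∣ Nat.count (fun j => P (g j)) p := by
    intro P _
    rw [← count_shift_of_periodic (fun j => P (g j)) (fun j => by simp only [hg j]) (p - 1),
      ← countP_range, ← hJp.countP_eq]
    have : J.countP (fun j => decide (P (g (j + (p - 1))))) =
        (J.map (fun j => g (j + (p - 1)))).countP (fun c => decide (P c)) := by
      rw [List.countP_map]; rfl
    rw [this, hb, countP_stretch]
    exact dvd_mul_right _ _
  induction l generalizing x with
  -- All factors of length 0 are empty, so the predicate is constant.
  | zero => exact hlast (fun _ => factor g 0 0 < x)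
  | succ l ih =>
    cases x with
    | nil => simp [Nat.count_false]
    | cons c x =>
      have hsplit : ∀ t, Nat.count (fun j => factor g (l + 1) j < c :: x) t =
          Nat.count (fun j => g j < c) t +
            Nat.count (fun j => g j = c ∧ factor g l (j + 1) < x) t := by
        intro t
        induction t with
        | zero => simp
        | succ t iht =>
          rw [Nat.count_succ, Nat.count_succ, Nat.count_succ, iht]
          simp only [factor, List.cons_lt_cons_iff]
          by_cases h1 : g t < c
          · simp [h1, h1.ne]; omega
          · simp [h1]; omega
      rw [hsplit]
      refine dvd_add (hlast (· < c)) ?_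
      have hper : Function.Periodic (fun j => g j = c ∧ factor g l (j + 1) < x) p := by
        intro j
        simp only [hg j, show j + p + 1 = j + 1 + p by omega, factor_periodic hg l (j + 1)]
      -- Shifting by `p - 1` turns "letter `c`, then a tail below `x`" into "preceded by `c`, factor
      -- below `x`".
      rw [← count_shift_of_periodic _ hper (p - 1), ← countP_range, ← hJp.countP_eq]
      have h1 : J.countP (fun j => decide (g (j + (p - 1)) = c ∧
            factor g l (j + (p - 1) + 1) < x)) =
          ((J.filter (fun j => factor g l j < x)).map (fun j => g (j + (p - 1)))).countP
            (fun e => decide (e = c)) := by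
        rw [List.countP_map, List.countP_filter]
        apply List.countP_congr
        intro j _
        simp [show j + (p - 1) + 1 = j + p by omega, factor_periodic hg l j]
      have h2 := ih x
      rw [← countP_range, ← hJp.countP_eq] at h2
      obtain ⟨t, ht⟩ := h2
      have h3 := take_countP (fun j => decide (factor g l j < x)) hJ (by
        intro a b hab h
        simp only [decide_eq_true_eq] at h ⊢
        exact (factor_le_of_factor_le hn hgn hab l).trans_lt h)
      -- The positions below `x` are the first `i * t` of `J`; cutting `stretch i b` there splits no
      -- run, so `c` occurs a multiple of `i` times.
      rw [h1, ← h3, ht, List.map_take, hb, take_stretch, countP_stretch]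
      exact dvd_mul_right _ _

theorem map_last_not_stretch (hn : 0 < n) (hp : 0 < p) (hgn : Function.Periodic g n)
    (hg : Function.Periodic g p) (hJ : J.Pairwise fun a b => factor g n a ≤ factor g n b)
    (hJp : J.Perm (List.range p))
    (hinj : ∀ a < p, ∀ b < p, factor g n a = factor g n b → a = b) {i : ℕ} (hi : 1 < i)
    (b : List Ω) : J.map (fun j => g (j + (p - 1))) ≠ stretch i b := by
  intro hb
  have hlen : p = i * b.length := by
    have := congrArg List.length hb
    rwa [List.length_map, length_stretch, hJp.length_eq, List.length_range] at this
  have hlen' := hJp.length_eq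
  rw [List.length_range] at hlen'
  -- Since `i > 1` divides `p > 0`, there is a second position.
  have hp2 : 2 ≤ p := by
    have : b.length ≠ 0 := by
      intro h; rw [h] at hlen; omega
    have : i ≤ i * b.length := Nat.le_mul_of_pos_right _ (by omega)
    omega
  match J, hJ, hJp, hb, hlen' with
  | [], _, _, _, h => simp at h; omega
  | [_], _, _, _, h => simp at h; omega
  | a :: c :: J, hJ, hJp, hb, _ =>
    have hd := dvd_count_factor_lt hn hp hgn hg hJ hJp hb n (factor g n c)
    have hnd : (a :: c :: J).Nodup := hJp.nodup_iff.2 List.nodup_range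
    have hmem : ∀ e ∈ a :: c :: J, e < p := fun e he => List.mem_range.1 (hJp.subset he)
    have hac : factor g n a < factor g n c := by
      refine lt_of_le_of_ne ((List.pairwise_cons.1 hJ).1 c (by simp)) fun h => ?_
      have := hinj a (hmem a (by simp)) c (hmem c (by simp)) h
      simp [this] at hnd
    have hJ' := (List.pairwise_cons.1 (List.pairwise_cons.1 hJ).2).1
    rw [← countP_range, ← hJp.countP_eq, List.countP_cons, List.countP_cons,
      List.countP_eq_zero.2 (fun e he => by simpa using hJ' e he)] at hd
    simp [hac] at hd
    omega

end Sorted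

/-! ### Rotations and occurrences as factors of `sss…`. -/

section Periodization

variable {Ω : Type*}

/-- The infinite word `sss…`. -/
def periodization (s : List Ω) (hs : 0 < s.length) (i : ℕ) : Ω :=
  s[i % s.length]'(Nat.mod_lt _ hs)

theorem periodization_periodic (s : List Ω) (hs : 0 < s.length) :
    Function.Periodic (periodization s hs) s.length := by
  intro i
  simp [periodization]

theorem rotate_eq_factor (s : List Ω) (hs : 0 < s.length) (j : ℕ) :
    s.rotate j = factor (periodization s hs) s.length j := by
  apply List.ext_getElem (by simp)
  intro i _ _
  simp [periodization, List.getElem_rotate, Nat.add_comm]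

theorem periodization_periodic_of_rotate_eq {s : List Ω} (hs : 0 < s.length) {p : ℕ}
    (hp : s.rotate p = s) : Function.Periodic (periodization s hs) p := by
  intro i
  have h : s.rotate (i + p) = s.rotate i := by
    rw [Nat.add_comm, ← List.rotate_rotate, hp]
  rw [rotate_eq_factor s hs, rotate_eq_factor s hs] at h
  have h1 : (factor (periodization s hs) s.length (i + p))[0]'(by simpa) =
    (factor (periodization s hs) s.length i)[0]'(by simpa) := by simp only [h]
  simpa using h1

theorem wordPow_succ (t : List Ω) (i : ℕ) : wordPow t (i + 1) = t ++ wordPow t i := by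
  simp [wordPow, List.replicate_succ]

theorem wordPow_factor {g : ℕ → Ω} {n : ℕ} (hg : Function.Periodic g n) (j i : ℕ) :
    wordPow (factor g n j) i = factor g (i * n) j := by
  have happ : ∀ a b j, factor g (a + b) j = factor g a j ++ factor g b (j + a) := by
    intro a b
    induction a with
    | zero => simp [factor]
    | succ a ih =>
      intro j
      rw [Nat.succ_add, factor, factor, ih, List.cons_append,
        show j + 1 + a = j + (a + 1) by omega]
  induction i with
  | zero => simp [wordPow, factor]
  | succ i ih => rw [wordPow_succ, ih, Nat.succ_mul, Nat.add_comm, happ, factor_periodic hg]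

theorem prefix_factor_iff (g : ℕ → Ω) (w : List Ω) (l j : ℕ) :
    w <+: factor g l j ↔ w.length ≤ l ∧ w = factor g w.length j := by
  induction w generalizing l j with
  | nil => simp [factor]
  | cons a w ih =>
    cases l with
    | zero => simp [factor]
    | succ l =>
      simp only [factor, List.cons_prefix_cons, ih, List.length_cons, List.cons.injEq]
      constructor
      · rintro ⟨h, h1, h2⟩
        exact ⟨by omega, h, h2⟩
      · rintro ⟨h1, h, h2⟩
        exact ⟨h, by omega, h2⟩

theorem cyclicPermutations_eq_map {s : List Ω} (hs : 0 < s.length) :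
    s.cyclicPermutations = (List.range s.length).map fun j => s.rotate j := by
  have hne : s ≠ [] := by rintro rfl; simp at hs
  apply List.ext_getElem
  · simp [List.length_cyclicPermutations_of_ne_nil s hne]
  · intro i _ _
    simp [List.getElem_cyclicPermutations]

theorem occurrences_eq_count [DecidableEq Ω] {s : List Ω} (hs : 0 < s.length) (w : List Ω) :
    occurrences (s : Cycle Ω) w =
      Nat.count (fun j => factor (periodization s hs) w.length j = w) s.length := by
  classical
  have hg := periodization_periodic s hs
  rw [occurrences, Cycle.lists_coe, Multiset.coe_countP, cyclicPermutations_eq_map hs,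
    List.countP_map, ← countP_range]
  apply List.countP_congr
  intro j _
  simp only [Function.comp_apply, decide_eq_true_eq, rotate_eq_factor s hs, wordPow_factor hg,
    prefix_factor_iff]
  constructor
  · rintro ⟨_, _, h⟩
    exact h.symm
  · intro h
    exact ⟨w.length, Nat.le_mul_of_pos_right _ hs, h.symm⟩

theorem occurrences_nil {w : List Ω} (hw : w ≠ []) :
    occurrences (([] : List Ω) : Cycle Ω) w = 0 := by
  classical
  have : ∀ i, wordPow ([] : List Ω) i = [] := by
    intro i
    simp [wordPow]
  -- The empty cycle still lists one rotation, the empty word, whose powers are all empty.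
  have hl : ((([] : List Ω) : Cycle Ω)).lists = (([[]] : List (List Ω)) : Multiset (List Ω)) := rfl
  rw [occurrences, hl, Multiset.coe_countP]
  simp [this, hw]

end Periodization

/-! ### The Burrows-Wheeler table reduced to one period. -/

section Table

variable {Ω : Type*} [LinearOrder Ω]

/-- The positions of one period, sorted by the words of length `n` that start there. -/
def sortedPositions (g : ℕ → Ω) (n p : ℕ) : List ℕ :=
  (List.range p).insertionSort (fun a b => factor g n a ≤ factor g n b)

theorem sortedPositions_perm (g : ℕ → Ω) (n p : ℕ) :
    (sortedPositions g n p).Perm (List.range p) :=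
  List.perm_insertionSort _ _

theorem sortedPositions_pairwise (g : ℕ → Ω) (n p : ℕ) :
    (sortedPositions g n p).Pairwise fun a b => factor g n a ≤ factor g n b := by
  have : Std.Total (fun a b => factor g n a ≤ factor g n b) :=
    ⟨fun a b => le_total (factor g n a) (factor g n b)⟩
  have : IsTrans ℕ (fun a b => factor g n a ≤ factor g n b) := ⟨fun _ _ _ h h' => le_trans h h'⟩
  exact List.pairwise_insertionSort _ _

/-- Both sides are sorted, so it suffices that each row has the same multiplicity; by periodicity,
its count over `d * p` positions is `d` times that over `p`. -/
theorem bwtTable_eq_stretch {s : List Ω} (hs : 0 < s.length) {d p : ℕ} (hdp : s.length = d * p)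
    (hp : s.rotate p = s) :
    bwtTable s = stretch d ((sortedPositions (periodization s hs) s.length p).map
      (factor (periodization s hs) s.length)) := by
  apply List.Perm.eq_of_pairwise (le := (· ≤ ·)) (fun a b _ _ h h' => le_antisymm h h')
  · exact List.pairwise_insertionSort _ _
  · exact pairwise_stretch (fun a => le_refl a) d (List.pairwise_map.2 (sortedPositions_pairwise _ _ _))
  · refine (List.perm_insertionSort _ _).trans (List.perm_iff_count.2 fun v => ?_)
    have hg := periodization_periodic_of_rotate_eq hs hp
    have hP : Function.Periodic (fun j => factor (periodization s hs) s.length j = v) p := by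
      intro j
      simp only [factor_periodic hg s.length j]
    have h1 : ∀ t, ((List.range t).map fun j => factor (periodization s hs) s.length j).count v =
        Nat.count (fun j => factor (periodization s hs) s.length j = v) t := by
      intro t
      rw [← countP_range, List.count, List.countP_map]
      apply List.countP_congr
      intro j _
      simp
    rw [count_stretch, ((sortedPositions_perm _ _ p).map _).count_eq]
    simp only [rotate_eq_factor s hs]
    rw [h1, h1, ← count_mul_of_periodic _ hP, ← hdp]

theorem BWT_eq_stretch {s : List Ω} (hs : 0 < s.length) {d p : ℕ} (hdp : s.length = d * p)
    (hp : s.rotate p = s) :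
    BWT s = stretch d ((sortedPositions (periodization s hs) s.length p).map
      fun j => periodization s hs (j + (p - 1))) := by
  have hp0 : 0 < p := Nat.pos_of_ne_zero (by rintro rfl; omega)
  have hd0 : 0 < d := Nat.pos_of_ne_zero (by rintro rfl; omega)
  have hg := periodization_periodic_of_rotate_eq hs hp
  rw [BWT, bwtTable_eq_stretch hs hdp hp, stretch, stretch, List.flatMap_map, List.flatMap_map,
    List.filterMap_flatMap]
  congr 1
  funext j
  apply List.filterMap_replicate_of_some
  rw [List.getLast?_eq_getElem?, List.getElem?_eq_getElem (by simpa using hs), getElem_factor,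
    length_factor]
  congr 1
  obtain ⟨e, rfl⟩ : ∃ e, d = e + 1 := ⟨d - 1, by omega⟩
  -- The last letter of a row sits at `j + n - 1`, which is `j + (p - 1)` modulo the period.
  rw [hdp, Nat.succ_mul, show j + (e * p + p - 1) = j + (p - 1) + e * p by omega]
  exact hg.nat_mul e _

end Table

/-! ### Maximality of the order makes the rows of one period distinct. -/

section Order

variable {Ω : Type*}

theorem rotate_gcd_eq {s : List Ω} {a b : ℕ} (ha : s.rotate a = s) (hb : s.rotate b = s) :
    s.rotate (a.gcd b) = s := by
  have hit : ∀ t, (fun u : List Ω => u.rotate 1)^[t] s = s.rotate t := by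
    intro t
    induction t with
    | zero => simp
    | succ t ih => rw [Function.iterate_succ_apply', ih, List.rotate_rotate]
  have h := Function.IsPeriodicPt.gcd (f := fun u : List Ω => u.rotate 1) (x := s) (m := a)
    (n := b) ((hit a).trans ha) ((hit b).trans hb)
  exact (hit _).symm.trans h

/-- Two equal rotations would fix `s` under rotation by `b - a`, hence by `e = gcd (b - a) n`. As `e
< n / d`, this gives a rotation of order `n / e > d`. -/
theorem rotate_injOn_of_isOrder {s : List Ω} (hs : 0 < s.length) {d : ℕ}
    (hd : IsOrder (s : Cycle Ω) d) {a b : ℕ} (ha : a < s.length / d) (hb : b < s.length / d)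
    (hab : s.rotate a = s.rotate b) : a = b := by
  wlog h : a < b generalizing a b
  · rcases Nat.lt_trichotomy a b with h' | h' | h'
    · exact absurd h' h
    · exact h'
    · exact (this hb ha hab.symm h').symm
  exfalso
  have h1 : s.rotate (b - a) = s := by
    apply List.rotate_injective a
    simp only
    rw [List.rotate_rotate, Nat.sub_add_cancel h.le, hab]
  have h2 := rotate_gcd_eq h1 s.rotate_length
  set e := (b - a).gcd s.length
  have he : e ∣ s.length := Nat.gcd_dvd_right _ _
  have he0 : 0 < e := Nat.gcd_pos_of_pos_right _ hs
  have hle : e ≤ b - a := Nat.gcd_le_left _ (by omega)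
  have hrot : HasRotation s (s.length / e) := by
    refine ⟨Nat.div_dvd_of_dvd he, ?_⟩
    rwa [Nat.div_div_self he hs.ne']
  have hle' := hd.2 (show _ from (cycleHasRotation_coe s _).2 hrot)
  have hds : d ∣ s.length := ((cycleHasRotation_coe s d).1 hd.1).1
  obtain ⟨c, hc⟩ := he
  obtain ⟨f, hf⟩ := hds
  have hd0 : 0 < d := Nat.pos_of_ne_zero (by rintro rfl; omega)
  rw [hf, Nat.mul_div_cancel_left _ hd0] at hb
  rw [hc, Nat.mul_div_cancel_left _ he0] at hle'
  have : e * c < f * d := by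
    calc e * c ≤ e * d := Nat.mul_le_mul_left _ hle'
      _ < f * d := Nat.mul_lt_mul_of_pos_right (by omega) hd0
  rw [Nat.mul_comm f d] at this
  omega

end Order

/-! ### Blocks with a common prefix are codewords. -/

section Codewords

variable {Ω : Type*} [LinearOrder Ω] [Fintype Ω]

/-- The words of length `l`, in lexicographic order. -/
noncomputable def sortedWords (Ω : Type*) [LinearOrder Ω] [Fintype Ω] (l : ℕ) : List (List Ω) :=
  ((Finset.univ : Finset (Fin l → Ω)).image List.ofFn).sort (· ≤ ·)

theorem length_sortedWords (l : ℕ) :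
    (sortedWords Ω l).length = Fintype.card Ω ^ l := by
  rw [sortedWords, Finset.length_sort, Finset.card_image_of_injective _ List.ofFn_injective]
  simp

theorem mem_sortedWords {l : ℕ} {w : List Ω} : w ∈ sortedWords Ω l ↔ w.length = l := by
  rw [sortedWords, Finset.mem_sort, Finset.mem_image]
  constructor
  · rintro ⟨f, -, rfl⟩
    simp
  · rintro rfl
    exact ⟨w.get, Finset.mem_univ _, List.ofFn_get w⟩

theorem sortedWords_pairwise (l : ℕ) : (sortedWords Ω l).Pairwise (· < ·) :=
  (Finset.sortedLT_sort _).pairwise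

theorem mem_codewords_iff {M : ℕ} {w : List Ω} :
    w ∈ codewords Ω M ↔ ∀ c, w.count c = M := by
  have h : ∀ c : Ω, (stretch M ((Finset.univ : Finset Ω).sort (· ≤ ·))).count c = M := by
    intro c
    rw [count_stretch, List.count_eq_one_of_mem (Finset.sort_nodup _ _) (by simp), mul_one]
  change w.Perm _ ↔ _
  rw [List.perm_iff_count]
  simp only [h]

theorem map_last_mem_pow {g : ℕ → Ω} {n p M l : ℕ} (hn : 0 < n) (hp : 0 < p)
    (hgn : Function.Periodic g n) (hg : Function.Periodic g p)
    (hM : ∀ w : List Ω, w.length = l + 1 → Nat.count (fun j => factor g (l + 1) j = w) p = M) :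
    (sortedPositions g n p).map (fun j => g (j + (p - 1))) ∈
      codewords Ω M ^ Fintype.card Ω ^ l := by
  rw [Language.mem_pow]
  refine ⟨(sortedWords Ω l).map fun x =>
    ((sortedPositions g n p).filter fun j => factor g l j = x).map fun j => g (j + (p - 1)),
    ?_, by rw [List.length_map, length_sortedWords], ?_⟩
  · conv_lhs => rw [← flatMap_filter_eq_self (factor g l)
      (fun a b h => factor_le_of_factor_le hn hgn h l) (sortedWords_pairwise l)
      (sortedPositions_pairwise g n p) (fun a _ => mem_sortedWords.2 (length_factor g l a))]
    rw [List.map_flatMap, List.flatMap_def]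
    congr!
  · intro y hy
    obtain ⟨x, hx, rfl⟩ := List.mem_map.1 hy
    rw [mem_codewords_iff]
    intro c
    -- An occurrence of `c :: x` is a position followed by `x` and preceded by `c`.
    rw [← hM (c :: x) (by simp [mem_sortedWords.1 hx])]
    have hper : Function.Periodic (fun j => factor g (l + 1) j = c :: x) p := by
      intro j
      simp only [factor_periodic hg (l + 1) j]
    rw [← count_shift_of_periodic _ hper (p - 1), ← countP_range,
      ← (sortedPositions_perm g n p).countP_eq, List.count, List.countP_map, List.countP_filter]
    apply List.countP_congr
    intro j _
    simp [factor, show j + (p - 1) + 1 = j + p by omega, factor_periodic hg l j]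

end Codewords

end MultiDeBruijn

/-! ### Assembly of the theorem. -/

theorem mainTheorem8 {Ω : Type*} [LinearOrder Ω] [Fintype Ω] (m q k d : ℕ)
    (hm : 1 ≤ m) (hq : 1 ≤ q) (hk : 1 ≤ k) (hΩ : Fintype.card Ω = q)
    (s : List Ω) (hs : (s : Cycle Ω) ∈ MultiDeBruijn.cyclicMDBOfOrder Ω d m k) :
    d ∣ m ∧
      ∃ u : List Ω,
        MultiDeBruijn.BWT s = MultiDeBruijn.stretch d u ∧
          u ∈ MultiDeBruijn.codewords Ω (m / d) ^ q ^ (k - 1) ∧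
          u ∈ MultiDeBruijn.nonStretched Ω := by
  open MultiDeBruijn in
  obtain ⟨hocc, hord⟩ := hs
  have : Nonempty Ω := Fintype.card_pos_iff.1 (by omega)
  obtain ⟨ω⟩ := this
  have hk' : (List.replicate k ω).length = k := List.length_replicate
  have hs : 0 < s.length := by
    rw [List.length_pos_iff]
    rintro rfl
    have := hocc _ hk'
    rw [occurrences_nil (by rw [← List.length_pos_iff]; omega)] at this
    omega
  obtain ⟨hdvd, hrot⟩ := (cycleHasRotation_coe s d).1 hord.1
  have hd : 0 < d := Nat.pos_of_dvd_of_pos hdvd hs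
  set p := s.length / d with hpdef
  have hdp : s.length = d * p := (Nat.mul_div_cancel' hdvd).symm
  have hp : 0 < p := Nat.pos_of_ne_zero (by intro h; rw [h] at hdp; omega)
  have hgn := periodization_periodic s hs
  have hg := periodization_periodic_of_rotate_eq hs hrot
  -- The `m` occurrences of `w` are spread evenly over `d` periods; this gives both `d ∣ m` and the
  -- count `m / d` per period.
  have hcount : ∀ w : List Ω, w.length = k →
      m = d * Nat.count (fun j => factor (periodization s hs) k j = w) p := by
    intro w hw
    have hP : Function.Periodic (fun j => factor (periodization s hs) k j = w) p := by
      intro j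
      simp only [factor_periodic hg k j]
    have := hocc w hw
    rw [occurrences_eq_count hs, hw, hdp] at this
    rw [← this, ← hdp, ← count_mul_of_periodic _ hP, ← hdp]
  refine ⟨⟨_, hcount _ hk'⟩, _, BWT_eq_stretch hs hdp hrot, ?_, ?_, ?_⟩
  · rw [← hΩ]
    obtain ⟨l, rfl⟩ : ∃ l, k = l + 1 := ⟨k - 1, by omega⟩
    apply map_last_mem_pow hs hp hgn hg
    intro w hw
    rw [hcount w hw, Nat.mul_div_cancel_left _ hd]
    rfl
  · rw [← List.length_pos_iff, List.length_map, (sortedPositions_perm _ _ p).length_eq,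
      List.length_range]
    exact hp
  · rintro ⟨i, hi, b, hb⟩
    refine map_last_not_stretch hs hp hgn hg (sortedPositions_pairwise _ _ p)
      (sortedPositions_perm _ _ p) ?_ hi b hb
    intro a ha c hc hac
    rw [← rotate_eq_factor, ← rotate_eq_factor] at hac
    exact rotate_injOn_of_isOrder hs hord ha hc hac
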